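/- Let $M$ be a finite-dimensional smooth manifold. For a manifold $Q$ let $\pi_Q:T^*Q\to Q$ be the cotangent bundle, $\theta_Q$ the Liouville one-form, $\langle(\theta_Q)_\varepsilon,X\rangle=\langle\varepsilon,T\pi_Q X\rangle$, and $\omega_Q=-\mathrm d\theta_Q$. Put $\Omega=pr_1^*\omega_M-pr_0^*\omega_M$ on $T^*M\times T^*M$, where $pr_0,pr_1$ are the two projections onto $T^*M$, and let $$\Upsilon:T^*(M\times M)\to T^*M\times T^*M,\qquad (\gamma_{q_0},\gamma_{q_1})\mapsto(-\gamma_{q_0},\gamma_{q_1}).$$ For an embedded submanifold $C\subset Q$ and a smooth function $f:C\to\mathbb R$ put $$\Sigma_f=\{\mu\in T^*Q\;:\;\pi_Q(\mu)\in C,\ \langle\mu,v\rangle=\langle \mathrm df,v\rangle\ \text{ for all } v\in T_{\pi_Q(\mu)}C\}.$$ Let $\Lambda$ be a Lagrangian submanifold of $(T^*M\times T^*M,\Omega)$, that is, an embedded submanifold to which $\Omega$ restricts to $0$ and whose dimension is half of $\dim(T^*M\times T^*M)$. Let $N=\Upsilon^{-1}(\Lambda)\subset T^*(M\times M)$, with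 inclusion $i_N$. Assume that $N$ has a global generating function for the Liouville form, that is, a smooth function $S:N\to\mathbb R$ with $i_N^*\theta_{M\times M}=\mathrm dS$. Assume also that $\pi_{M\times M}|_N$ is a submersion with connected fibres onto an embedded submanifold $C_d\subset M\times M$. Then $S$ descends to a discrete Lagrangian: there is a smooth function $L_d:C_d\to\mathbb R$ with $S=L_d\circ\pi_{M\times M}|_N$, and $N\subseteq\Sigma_{L_d}$. If moreover, for every $q\in M\times M$, the set $N\cap T_q^*(M\times M)$ is closed in $T_q^*(M\times M)$ (for example, if $\Lambda$ is a closed subset of $T^*M\times T^*M$), then $$\Upsilon^{-1}(\Lambda)=\Sigma_{L_d},\qquad\text{and hence}\qquad \Lambda=\Upsilon(\Sigma_{L_d}).$$ In this case $\Lambda$ is the dynamics of the discrete constrained variational problem $(C_d,L_d)$, whose solutions are the sequences $\gamma_0,\gamma_1,\dots$ in $T^*M$ with $(\gamma_i,\gamma_{i+1})\in\Upsilon(\Sigma_{L_d})$ for all $i$. -/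

import Mathlib

open Bundle Set Manifold
open scoped ContDiff

noncomputable section

namespace DiscreteMechanics

section Forms

variable {E : Type*} [NormedAddCommGroup E] [NormedSpace ℝ E] {H : Type*} [TopologicalSpace H]
  (I : ModelWithCorners ℝ E H) {P : Type*} [TopologicalSpace P] [ChartedSpace H P]

/-- Exterior derivative `dα` of a one-form `α` on a manifold without boundary. In the preferred
chart `φ` around `x`, with `a` the coordinate expression of `α`,
`dα(u, v) = (D a · u) v - (D a · v) u`. -/
def extDerivOneForm (α : ∀ x : P, TangentSpace I x →L[ℝ] ℝ) (x : P) (u v : TangentSpace I x) : ℝ :=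
  let a : E → E →L[ℝ] ℝ := fun y =>
    (α ((extChartAt I x).symm y)).comp (mfderiv 𝓘(ℝ, E) I (extChartAt I x).symm y)
  let u' : E := mfderiv I 𝓘(ℝ, E) (extChartAt I x) x u
  let v' : E := mfderiv I 𝓘(ℝ, E) (extChartAt I x) x v
  fderiv ℝ a (extChartAt I x x) u' v' - fderiv ℝ a (extChartAt I x x) v' u'

/-- `ι : L → P` is (the inclusion of) a Lagrangian submanifold of `P` for the two-form `Ω`:
an embedded submanifold with `ι^* Ω = 0` and `dim L = (1/2) dim P`. -/
structure IsLagrangianSubmanifold (Ω : ∀ x : P, TangentSpace I x → TangentSpace I x → ℝ)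
    (G : Type*) [NormedAddCommGroup G] [NormedSpace ℝ G]
    {L : Type*} [TopologicalSpace L] [ChartedSpace G L] (ι : L → P) : Prop where
  isSmoothEmbedding : IsSmoothEmbedding 𝓘(ℝ, G) I ∞ ι
  isotropic : ∀ (x : L) (u v : TangentSpace 𝓘(ℝ, G) x),
    Ω (ι x) (mfderiv 𝓘(ℝ, G) I ι x u) (mfderiv 𝓘(ℝ, G) I ι x v) = 0
  two_mul_dim : 2 * Module.finrank ℝ G = Module.finrank ℝ E

end Forms

section Cotangent

variable {E : Type*} [NormedAddCommGroup E] [NormedSpace ℝ E] {H : Type*} [TopologicalSpace H]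
  (I : ModelWithCorners ℝ E H)

/-- The cotangent bundle `T^*Q`, with Mathlib's topology and manifold structure on the bundle of
continuous linear maps from the tangent bundle to `ℝ`. Its projection `π_Q` is
`Bundle.TotalSpace.proj`. -/
abbrev CotangentBundle (Q : Type*) [TopologicalSpace Q] [ChartedSpace H Q] [IsManifold I ∞ Q] :
    Type _ :=
  TotalSpace (E →L[ℝ] ℝ) (fun q : Q => TangentSpace I q →L[ℝ] ℝ)

/-- The model with corners of the cotangent bundle. -/
abbrev cotangentModel : ModelWithCorners ℝ (E × (E →L[ℝ] ℝ)) (ModelProd H (E →L[ℝ] ℝ)) :=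
  I.prod 𝓘(ℝ, E →L[ℝ] ℝ)

variable {Q : Type*} [TopologicalSpace Q] [ChartedSpace H Q] [IsManifold I ∞ Q]

/-- The Liouville one-form `θ_Q` on `T^*Q`: `⟨θ_ε, X⟩ = ⟨ε, Tπ_Q X⟩`. -/
def liouville (ε : CotangentBundle I Q) : TangentSpace (cotangentModel I) ε →L[ℝ] ℝ :=
  ε.2.comp (mfderiv (cotangentModel I) I
    (TotalSpace.proj : CotangentBundle I Q → Q) ε)

/-- The canonical symplectic form `ω_Q = -dθ_Q` on `T^*Q`. -/
def canonicalForm (ε : CotangentBundle I Q) (X Y : TangentSpace (cotangentModel I) ε) : ℝ :=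
  -extDerivOneForm (cotangentModel I) (liouville I (Q := Q)) ε X Y

/-- The form `Ω = pr₁^* ω_Q - pr₀^* ω_Q` on `T^*Q × T^*Q`. -/
def productForm (z : CotangentBundle I Q × CotangentBundle I Q)
    (X Y : TangentSpace ((cotangentModel I).prod (cotangentModel I)) z) : ℝ :=
  canonicalForm I z.2
      (mfderiv ((cotangentModel I).prod (cotangentModel I)) (cotangentModel I) Prod.snd z X)
      (mfderiv ((cotangentModel I).prod (cotangentModel I)) (cotangentModel I) Prod.snd z Y)
    - canonicalForm I z.1
      (mfderiv ((cotangentModel I).prod (cotangentModel I)) (cotangentModel I) Prod.fst z X)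
      (mfderiv ((cotangentModel I).prod (cotangentModel I)) (cotangentModel I) Prod.fst z Y)

/-- `S : N → ℝ` is a (global) generating function, for the Liouville form, of the submanifold
of `T^*Q` with inclusion `i : N → T^*Q`: it is smooth and `i^* θ_Q = dS`. -/
def IsGeneratingFunction (G : Type*) [NormedAddCommGroup G] [NormedSpace ℝ G]
    {N : Type*} [TopologicalSpace N] [ChartedSpace G N]
    (i : N → CotangentBundle I Q) (S : N → ℝ) : Prop :=
  ContMDiff 𝓘(ℝ, G) 𝓘(ℝ, ℝ) ∞ S ∧
    ∀ (x : N) (v : TangentSpace 𝓘(ℝ, G) x),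
      liouville I (i x) (mfderiv 𝓘(ℝ, G) (cotangentModel I) i x v)
        = mfderiv 𝓘(ℝ, G) 𝓘(ℝ, ℝ) S x v

/-- For a submanifold `j : C → Q` and a function `f : C → ℝ`, the subset `Σ_f` of `T^*Q`
of the covectors `μ` at points `j c` of `C` such that `⟨μ, v⟩ = ⟨df, v⟩` for all `v ∈ T_c C`. -/
def sigma (F : Type*) [NormedAddCommGroup F] [NormedSpace ℝ F]
    {C : Type*} [TopologicalSpace C] [ChartedSpace F C]
    (j : C → Q) (f : C → ℝ) : Set (CotangentBundle I Q) :=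
  {γ | ∃ (c : C) (μ : TangentSpace I (j c) →L[ℝ] ℝ), γ = ⟨j c, μ⟩ ∧
    ∀ v : TangentSpace 𝓘(ℝ, F) c,
      μ (mfderiv 𝓘(ℝ, F) I j c v) = mfderiv 𝓘(ℝ, F) 𝓘(ℝ, ℝ) f c v}

end Cotangent

section Upsilon

variable {E : Type*} [NormedAddCommGroup E] [NormedSpace ℝ E] {H : Type*} [TopologicalSpace H]
  (I : ModelWithCorners ℝ E H)
  (M : Type*) [TopologicalSpace M] [ChartedSpace H M] [IsManifold I ∞ M]

/-- The bijection `Υ : T^*(M × M) → T^*M × T^*M`, `(γ_{q₀}, γ_{q₁}) ↦ (-γ_{q₀}, γ_{q₁})`, where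
`γ_{q₀}` and `γ_{q₁}` are the restrictions of `γ` to the two factors of
`T_{(q₀, q₁)}(M × M) = T_{q₀} M × T_{q₁} M`. -/
def upsilon : CotangentBundle (I.prod I) (M × M) ≃ CotangentBundle I M × CotangentBundle I M where
  toFun γ :=
    (⟨γ.1.1, -(γ.2.comp
      (ContinuousLinearMap.inl ℝ (TangentSpace I γ.1.1) (TangentSpace I γ.1.2)))⟩,
     ⟨γ.1.2, γ.2.comp
      (ContinuousLinearMap.inr ℝ (TangentSpace I γ.1.1) (TangentSpace I γ.1.2))⟩)
  invFun z := ⟨(z.1.1, z.2.1), ContinuousLinearMap.coprod (-z.1.2) z.2.2⟩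
  left_inv := by
    rintro ⟨⟨q₀, q₁⟩, γ⟩
    refine congrArg (TotalSpace.mk (q₀, q₁)) ?_
    refine ContinuousLinearMap.ext fun v => ?_
    obtain ⟨v₀, v₁⟩ := v
    change -(-(γ (v₀, 0))) + γ (0, v₁) = γ (v₀, v₁)
    rw [neg_neg]
    refine (γ.map_add (v₀, 0) (0, v₁)).symm.trans (congrArg γ ?_)
    exact Prod.ext (add_zero v₀) (zero_add v₁)
  right_inv := by
    rintro ⟨⟨q₀, α⟩, ⟨q₁, β⟩⟩
    refine Prod.ext (congrArg (TotalSpace.mk q₀) ?_) (congrArg (TotalSpace.mk q₁) ?_)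
    · refine ContinuousLinearMap.ext fun v => ?_
      change -(-(α v) + β 0) = α v
      rw [map_zero, add_zero, neg_neg]
    · refine ContinuousLinearMap.ext fun v => ?_
      change -(α 0) + β v = β v
      rw [map_zero, neg_zero, zero_add]

variable {M}

/-- The dynamics `Υ(Σ_{L_d}) ⊆ T^*M × T^*M` of the discrete constrained variational problem with
constraint submanifold `j : C → M × M` and discrete Lagrangian `Ld : C → ℝ`; its solutions are the
sequences `γ₀, γ₁, …` in `T^*M` whose consecutive pairs lie in this set. -/
def discreteDynamics (F : Type*) [NormedAddCommGroup F] [NormedSpace ℝ F]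
    {C : Type*} [TopologicalSpace C] [ChartedSpace F C]
    (j : C → M × M) (Ld : C → ℝ) : Set (CotangentBundle I M × CotangentBundle I M) :=
  upsilon I M '' sigma (I.prod I) F j Ld

end Upsilon

end DiscreteMechanics

end

/-! Write `i = Υ⁻¹ ∘ ι` for the inclusion of `N` and `Q = M × M`. Since `π ∘ i = j ∘ p`, the
definition of the Liouville form gives `dS_x(v) = ⟨i x, Tj (Tp v)⟩`
(`IsGeneratingFunction.apply_mfderiv_mfderiv`), and both halves of the theorem rest on this
identity. It shows that `dS` kills vectors vertical for `p`, so `S` is constant on the connected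
fibres and descends smoothly along local sections (`exists_contMDiff_descent`). As `Tp` is onto, it
then says that `i x` restricts to `dL_d` on `T C_d`, which is the inclusion `N ⊆ Σ_{L_d}`.

For equality, fix `c ∈ C_d`. The fibre of `Σ_{L_d}` over `c` is an affine space `A` modelled on the
annihilator of `T_c C_d`, of dimension `dim Q - dim C_d`. As `dim N = dim Q`, the fibre of `p` over
`c` has this same dimension, and `i` immerses it in `A`; by the inverse function theorem its image
is open in `A` (`eventually_exists_eq_mk`). The image is nonempty, and closed by assumption, so it
is all of the convex set `A`. -/

namespace DiscreteMechanics

open scoped Topology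
open Filter

/-! ### Coordinates on the cotangent bundle -/

section Coordinates

variable {E : Type*} [NormedAddCommGroup E] [NormedSpace ℝ E] {H : Type*} [TopologicalSpace H]
  {I : ModelWithCorners ℝ E H} {Q : Type*} [TopologicalSpace Q] [ChartedSpace H Q]
  [IsManifold I ∞ Q]

theorem trivializationAt_cotangentBundle_snd (q₀ : Q) (γ : CotangentBundle I Q) :
    (trivializationAt (E →L[ℝ] ℝ) (fun q : Q => TangentSpace I q →L[ℝ] ℝ) q₀ γ).2 =
      γ.2.comp ((trivializationAt E (TangentSpace I : Q → Type _) q₀).symmL ℝ γ.1) := by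
  have h : (trivializationAt (E →L[ℝ] ℝ) (fun q : Q => TangentSpace I q →L[ℝ] ℝ) q₀ γ) = _ :=
    hom_trivializationAt_apply (σ := RingHom.id ℝ) (F₁ := E) (E₁ := (TangentSpace I : Q → Type _))
      (F₂ := ℝ) (E₂ := fun _ : Q => ℝ) q₀ γ
  rw [h]
  ext v
  simp [ContinuousLinearMap.inCoordinates]

/-- `TangentSpace I q` is identified with `E` through the preferred chart at `q`, so the
trivialization of that chart changes nothing over `q` itself. -/
theorem symmL_trivializationAt_self (q : Q) :
    (trivializationAt E (TangentSpace I : Q → Type _) q).symmL ℝ q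
      = ContinuousLinearMap.id ℝ E := by
  have : IsManifold I 1 Q := IsManifold.of_le (n := ∞) (by simp)
  rw [TangentBundle.symmL_trivializationAt (mem_chart_source H q)]
  exact mfderivWithin_range_extChartAt_symm

theorem trivializationAt_cotangentBundle_snd_self (q : Q) (μ : TangentSpace I q →L[ℝ] ℝ) :
    (trivializationAt (E →L[ℝ] ℝ) (fun q : Q => TangentSpace I q →L[ℝ] ℝ) q ⟨q, μ⟩).2 = μ := by
  rw [trivializationAt_cotangentBundle_snd]
  ext v
  simp only [symmL_trivializationAt_self]
  rfl

/-- A map into the cotangent bundle is smooth at a point iff its base component and its fibre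
component in the preferred trivialization are. -/
theorem contMDiffAt_cotangentBundle_iff {E' : Type*} [NormedAddCommGroup E'] [NormedSpace ℝ E']
    {H' : Type*} [TopologicalSpace H'] {J : ModelWithCorners ℝ E' H'}
    {P : Type*} [TopologicalSpace P] [ChartedSpace H' P] {n : WithTop ℕ∞}
    {f : P → CotangentBundle I Q} {x : P} :
    ContMDiffAt J (cotangentModel I) n f x ↔
      ContMDiffAt J I n (fun y => (f y).proj) x ∧
      ContMDiffAt J 𝓘(ℝ, E →L[ℝ] ℝ) n (fun y => (f y).2.comp
        ((trivializationAt E (TangentSpace I : Q → Type _) (f x).proj).symmL ℝ (f y).1) :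
          P → E →L[ℝ] ℝ) x := by
  refine contMDiffAt_totalSpace.trans (and_congr Iff.rfl ?_)
  simp_rw [trivializationAt_cotangentBundle_snd]

/-- The inclusion of a fibre into the cotangent bundle is smooth. -/
theorem contMDiff_cotangentBundle_mk (q : Q) :
    ContMDiff 𝓘(ℝ, E →L[ℝ] ℝ) (cotangentModel I) ∞
      (fun μ : E →L[ℝ] ℝ => (⟨q, μ⟩ : CotangentBundle I Q)) := by
  intro μ
  rw [contMDiffAt_cotangentBundle_iff]
  refine ⟨contMDiffAt_const, ?_⟩
  simp only [symmL_trivializationAt_self]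
  exact contMDiffAt_id

end Coordinates

/-! ### `Υ` is a diffeomorphism -/

section Upsilon

variable {E : Type*} [NormedAddCommGroup E] [NormedSpace ℝ E] {H : Type*} [TopologicalSpace H]
  {I : ModelWithCorners ℝ E H} {M : Type*} [TopologicalSpace M] [ChartedSpace H M]
  [IsManifold I ∞ M]

/-- The preferred chart of a product is the product of the preferred charts, so the derivative of
its inverse splits. This makes `Υ` linear in the fibre coordinates. -/
theorem symmL_trivializationAt_prod {q₀ q : M × M}
    (h₁ : q.1 ∈ (chartAt H q₀.1).source) (h₂ : q.2 ∈ (chartAt H q₀.2).source) (v : E × E) :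
    (trivializationAt (E × E) (TangentSpace (I.prod I) : M × M → Type _) q₀).symmL ℝ q v =
      ((trivializationAt E (TangentSpace I : M → Type _) q₀.1).symmL ℝ q.1 v.1,
       (trivializationAt E (TangentSpace I : M → Type _) q₀.2).symmL ℝ q.2 v.2) := by
  have : IsManifold I 1 M := IsManifold.of_le (n := ∞) (by simp)
  rw [TangentBundle.symmL_trivializationAt h₁, TangentBundle.symmL_trivializationAt h₂,
    TangentBundle.symmL_trivializationAt (x₀ := q₀) (x := q)
      (by rw [prodChartedSpace_chartAt]; exact ⟨h₁, h₂⟩)]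
  have e : ((extChartAt (I.prod I) q₀).symm : E × E → M × M)
      = Prod.map (extChartAt I q₀.1).symm (extChartAt I q₀.2).symm := by
    rw [extChartAt_prod]; rfl
  have e' : extChartAt (I.prod I) q₀ q = (extChartAt I q₀.1 q.1, extChartAt I q₀.2 q.2) := by
    rw [extChartAt_prod]; rfl
  have hr : range (I.prod I) = range I ×ˢ range I := range_prodMap
  have key := mfderivWithin_prodMap (I := 𝓘(ℝ, E)) (I' := 𝓘(ℝ, E)) (J := I) (J' := I)
    (p := (extChartAt I q₀.1 q.1, extChartAt I q₀.2 q.2))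
    (s := range I) (t := range I)
    (f := (extChartAt I q₀.1).symm) (g := (extChartAt I q₀.2).symm)
    (mdifferentiableWithinAt_extChartAt_symm (by simp [h₁]))
    (mdifferentiableWithinAt_extChartAt_symm (by simp [h₂]))
    (I.uniqueDiffOn.uniqueMDiffOn _ (mem_range_self _))
    (I.uniqueDiffOn.uniqueMDiffOn _ (mem_range_self _))
  -- `key` uses the product of two copies of `𝓘(ℝ, E)`, the goal `𝓘(ℝ, E × E)`; the last two
  -- rewrites identify them.
  rw [e, e', hr, ← modelWithCornersSelf_prod, ← chartedSpaceSelf_prod] at *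
  exact DFunLike.congr_fun key v

/-- The inverse of `upsilon` is smooth. -/
theorem contMDiff_upsilon_symm :
    ContMDiff ((cotangentModel I).prod (cotangentModel I)) (cotangentModel (I.prod I)) ∞
      (upsilon I M).symm := by
  intro z₀
  have hz := contMDiffAt_cotangentBundle_iff.1
    (contMDiffAt_fst : ContMDiffAt ((cotangentModel I).prod (cotangentModel I)) (cotangentModel I)
      ∞ (Prod.fst : CotangentBundle I M × CotangentBundle I M → _) z₀)
  have hw := contMDiffAt_cotangentBundle_iff.1
    (contMDiffAt_snd : ContMDiffAt ((cotangentModel I).prod (cotangentModel I)) (cotangentModel I)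
      ∞ (Prod.snd : CotangentBundle I M × CotangentBundle I M → _) z₀)
  rw [contMDiffAt_cotangentBundle_iff]
  refine ⟨hz.1.prodMk hw.1, ?_⟩
  -- Pullbacks along the two projections: on fibre coordinates `Υ⁻¹` is `(α, β) ↦ -A α + B β`.
  let A : (E →L[ℝ] ℝ) →L[ℝ] (E × E →L[ℝ] ℝ) :=
    (ContinuousLinearMap.compL ℝ (E × E) E ℝ).flip (ContinuousLinearMap.fst ℝ E E)
  let B : (E →L[ℝ] ℝ) →L[ℝ] (E × E →L[ℝ] ℝ) :=
    (ContinuousLinearMap.compL ℝ (E × E) E ℝ).flip (ContinuousLinearMap.snd ℝ E E)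
  have hA := ((-A).contMDiff (n := ∞)).contMDiffAt.comp z₀ hz.2
  have hB := (B.contMDiff (n := ∞)).contMDiffAt.comp z₀ hw.2
  refine (hA.add hB).congr_of_eventuallyEq ?_
  have h₁ := hz.1.continuousAt.eventually
    ((chartAt H z₀.1.proj).open_source.mem_nhds (mem_chart_source H z₀.1.proj))
  have h₂ := hw.1.continuousAt.eventually
    ((chartAt H z₀.2.proj).open_source.mem_nhds (mem_chart_source H z₀.2.proj))
  filter_upwards [h₁, h₂] with z hz₁ hz₂
  refine ContinuousLinearMap.ext fun v => ?_
  have h := symmL_trivializationAt_prod (I := I) (q₀ := (z₀.1.proj, z₀.2.proj))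
    (q := (z.1.proj, z.2.proj)) hz₁ hz₂ v
  change ((-z.1.2).coprod z.2.2) ((trivializationAt (E × E)
    (TangentSpace (I.prod I) : M × M → Type _) (z₀.1.proj, z₀.2.proj)).symmL ℝ
      (z.1.proj, z.2.proj) v) = _
  rw [h]
  rfl

/-- The map `upsilon` is smooth. -/
theorem contMDiff_upsilon :
    ContMDiff (cotangentModel (I.prod I)) ((cotangentModel I).prod (cotangentModel I)) ∞
      (upsilon I M) := by
  intro γ₀
  have hγ := contMDiffAt_cotangentBundle_iff.1
    (contMDiffAt_id : ContMDiffAt (cotangentModel (I.prod I)) (cotangentModel (I.prod I))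
      ∞ (id : CotangentBundle (I.prod I) (M × M) → _) γ₀)
  -- Pullbacks along the two inclusions: on fibre coordinates `Υ` is `γ ↦ (-A γ, B γ)`.
  let A : (E × E →L[ℝ] ℝ) →L[ℝ] (E →L[ℝ] ℝ) :=
    (ContinuousLinearMap.compL ℝ E (E × E) ℝ).flip (ContinuousLinearMap.inl ℝ E E)
  let B : (E × E →L[ℝ] ℝ) →L[ℝ] (E →L[ℝ] ℝ) :=
    (ContinuousLinearMap.compL ℝ E (E × E) ℝ).flip (ContinuousLinearMap.inr ℝ E E)
  have hA := ((-A).contMDiff (n := ∞)).contMDiffAt.comp γ₀ hγ.2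
  have hB := (B.contMDiff (n := ∞)).contMDiffAt.comp γ₀ hγ.2
  have h₁ := hγ.1.fst.continuousAt.eventually
    ((chartAt H γ₀.proj.1).open_source.mem_nhds (mem_chart_source H γ₀.proj.1))
  have h₂ := hγ.1.snd.continuousAt.eventually
    ((chartAt H γ₀.proj.2).open_source.mem_nhds (mem_chart_source H γ₀.proj.2))
  refine ContMDiffAt.prodMk (contMDiffAt_cotangentBundle_iff.2 ⟨hγ.1.fst, ?_⟩)
    (contMDiffAt_cotangentBundle_iff.2 ⟨hγ.1.snd, ?_⟩)
  · refine hA.congr_of_eventuallyEq ?_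
    filter_upwards [h₁, h₂] with γ hγ₁ hγ₂
    refine ContinuousLinearMap.ext fun v => ?_
    have h := symmL_trivializationAt_prod (I := I) (q₀ := γ₀.proj) (q := γ.proj) hγ₁ hγ₂ (v, 0)
    rw [map_zero] at h
    exact congrArg (fun w => -γ.2 w) h.symm
  · refine hB.congr_of_eventuallyEq ?_
    filter_upwards [h₁, h₂] with γ hγ₁ hγ₂
    refine ContinuousLinearMap.ext fun v => ?_
    have h := symmL_trivializationAt_prod (I := I) (q₀ := γ₀.proj) (q := γ.proj) hγ₁ hγ₂ (0, v)
    rw [map_zero] at h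
    exact congrArg γ.2 h.symm

end Upsilon

/-! ### Derivatives of compositions -/

section Composition

variable {𝕜 : Type*} [NontriviallyNormedField 𝕜]
  {E₁ : Type*} [NormedAddCommGroup E₁] [NormedSpace 𝕜 E₁] {H₁ : Type*} [TopologicalSpace H₁]
  {I₁ : ModelWithCorners 𝕜 E₁ H₁} {M₁ : Type*} [TopologicalSpace M₁] [ChartedSpace H₁ M₁]
  {E₂ : Type*} [NormedAddCommGroup E₂] [NormedSpace 𝕜 E₂] {H₂ : Type*} [TopologicalSpace H₂]
  {I₂ : ModelWithCorners 𝕜 E₂ H₂} {M₂ : Type*} [TopologicalSpace M₂] [ChartedSpace H₂ M₂]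
  {E₃ : Type*} [NormedAddCommGroup E₃] [NormedSpace 𝕜 E₃] {H₃ : Type*} [TopologicalSpace H₃]
  {I₃ : ModelWithCorners 𝕜 E₃ H₃} {M₃ : Type*} [TopologicalSpace M₃] [ChartedSpace H₃ M₃]
  {g : M₂ → M₃} {f : M₁ → M₂} {x : M₁}

theorem injective_mfderiv_of_comp (hg : MDifferentiableAt I₂ I₃ g (f x))
    (hf : MDifferentiableAt I₁ I₂ f x)
    (h : Function.Injective (mfderiv I₁ I₃ (g ∘ f) x)) : Function.Injective (mfderiv I₁ I₂ f x) := by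
  rw [mfderiv_comp x hg hf] at h
  exact Function.Injective.of_comp (f := mfderiv I₂ I₃ g (f x)) h

theorem surjective_mfderiv_of_comp (hg : MDifferentiableAt I₂ I₃ g (f x))
    (hf : MDifferentiableAt I₁ I₂ f x) (h : Function.Surjective (mfderiv I₁ I₃ (g ∘ f) x)) :
    Function.Surjective (mfderiv I₂ I₃ g (f x)) := by
  rw [mfderiv_comp x hg hf] at h
  exact Function.Surjective.of_comp (g := mfderiv I₁ I₂ f x) h

end Composition

/-! ### Immersions -/

section Immersion

variable {G : Type*} [NormedAddCommGroup G] [NormedSpace ℝ G]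
  {N : Type*} [TopologicalSpace N] [ChartedSpace G N] [IsManifold 𝓘(ℝ, G) ∞ N]
  {E : Type*} [NormedAddCommGroup E] [NormedSpace ℝ E] {H : Type*} [TopologicalSpace H]
  {J : ModelWithCorners ℝ E H} {P : Type*} [TopologicalSpace P] [ChartedSpace H P]
  {f : N → P}

/-- In suitable charts an immersion is a linear inclusion into a product; the first component of the
target chart is a `g` with `g ∘ f` equal to the source chart near `x`, whose derivative is
injective. -/
theorem injective_mfderiv_of_isImmersion (hf : IsImmersion 𝓘(ℝ, G) J ∞ f) (x : N) :
    Function.Injective (mfderiv 𝓘(ℝ, G) J f x) := by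
  have : IsManifold 𝓘(ℝ, G) 1 N := IsManifold.of_le (n := ∞) (by simp)
  have h := hf.isImmersionOfComplement_complement x
  let g : P → G := (fun w => (h.equiv.symm w).1) ∘ h.codChart.extend J
  have hg : MDifferentiableAt J 𝓘(ℝ, G) g (f x) := by
    have h₁ : MDifferentiableAt J 𝓘(ℝ, E) (h.codChart.extend J) (f x) :=
      ((OpenPartialHomeomorph.contMDiffOn_extend h.codChart_mem_maximalAtlas).contMDiffAt
        (h.codChart.open_source.mem_nhds h.mem_codChart_source)).mdifferentiableAt (by simp)
    have h₂ : MDifferentiable 𝓘(ℝ, E) 𝓘(ℝ, G) (fun w => (h.equiv.symm w).1) :=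
      (differentiable_fst.comp h.equiv.symm.differentiable).mdifferentiable
    exact (h₂ _).comp _ h₁
  have hfx : MDifferentiableAt 𝓘(ℝ, G) J f x := (hf.contMDiff x).mdifferentiableAt (by simp)
  have heq : g ∘ f =ᶠ[𝓝 x] h.domChart := by
    filter_upwards [h.domChart.open_source.mem_nhds h.mem_domChart_source] with y hy
    have := h.writtenInCharts (show h.domChart y ∈ _ by simp [hy])
    simp only [Function.comp_apply, OpenPartialHomeomorph.extend_coe_symm,
      modelWithCornersSelf_coe_symm, id_eq, h.domChart.left_inv hy] at this
    simp only [g, Function.comp_apply, this, ContinuousLinearEquiv.symm_apply_apply]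
  have hD : MDifferentiableAt 𝓘(ℝ, G) 𝓘(ℝ, G) h.domChart x :=
    mdifferentiableAt_of_mem_maximalAtlas (IsManifold.maximalAtlas_subset_of_le (n := ∞) (by simp)
      h.domChart_mem_maximalAtlas) h.mem_domChart_source
  have hinj : Function.Injective (mfderiv 𝓘(ℝ, G) 𝓘(ℝ, G) h.domChart x) := by
    have hmem := IsManifold.maximalAtlas_subset_of_le (m := 1) (n := ∞) (by simp)
      h.domChart_mem_maximalAtlas
    exact OpenPartialHomeomorph.MDifferentiable.mfderiv_injective
      ⟨fun y hy => (mdifferentiableAt_of_mem_maximalAtlas hmem hy).mdifferentiableWithinAt,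
       fun y hy => (mdifferentiableAt_symm_of_mem_maximalAtlas hmem hy).mdifferentiableWithinAt⟩
      h.mem_domChart_source
  rw [← heq.mfderiv_eq] at hinj
  exact injective_mfderiv_of_comp hg hfx hinj

end Immersion

/-! ### Submersions: sections, fibres and descent of functions -/

section Submersion

variable {G : Type*} [NormedAddCommGroup G] [NormedSpace ℝ G]
  {L : Type*} [TopologicalSpace L] [ChartedSpace G L]
  {F : Type*} [NormedAddCommGroup F] [NormedSpace ℝ F]
  {C : Type*} [TopologicalSpace C] [ChartedSpace F C]
  {K : Type*} [NormedAddCommGroup K] [NormedSpace ℝ K]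
  {p : L → C} {x : L}

/-- Around every point, a submersion is a linear projection in suitable charts. -/
theorem exists_charts_of_isSubmersionAtOfComplement
    (h : IsSubmersionAtOfComplement K 𝓘(ℝ, G) 𝓘(ℝ, F) ∞ p x) :
    ∃ (Φ : OpenPartialHomeomorph L (F × K)) (ψ : OpenPartialHomeomorph C F),
      x ∈ Φ.source ∧ p x ∈ ψ.source ∧ MapsTo p Φ.source ψ.source ∧
      ContMDiffOn 𝓘(ℝ, G) 𝓘(ℝ, F × K) ∞ Φ Φ.source ∧
      ContMDiffOn 𝓘(ℝ, F × K) 𝓘(ℝ, G) ∞ Φ.symm Φ.target ∧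
      ContMDiffOn 𝓘(ℝ, F) 𝓘(ℝ, F) ∞ ψ ψ.source ∧
      ∀ y ∈ Φ.source, ψ (p y) = (Φ y).1 := by
  refine ⟨h.domChart.transHomeomorph h.equiv.toHomeomorph, h.codChart, h.mem_domChart_source,
    h.mem_codChart_source, h.mapsto_domChart_source_codChart_source, ?_, ?_, ?_, ?_⟩
  · exact (h.equiv.contDiff.contMDiff.comp_contMDiffOn
      (contMDiffOn_of_mem_maximalAtlas h.domChart_mem_maximalAtlas))
  · exact (contMDiffOn_symm_of_mem_maximalAtlas h.domChart_mem_maximalAtlas).comp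
      h.equiv.symm.contDiff.contMDiff.contMDiffOn (fun y hy => hy)
  · exact contMDiffOn_of_mem_maximalAtlas h.codChart_mem_maximalAtlas
  · intro y hy
    have hy' : y ∈ h.domChart.source := hy
    have := h.writtenInCharts (show h.domChart y ∈ _ by simp [hy'])
    simpa [h.domChart.left_inv hy'] using this

/-- A submersion has a smooth local section through every point. -/
theorem exists_section_of_isSubmersionAtOfComplement
    (h : IsSubmersionAtOfComplement K 𝓘(ℝ, G) 𝓘(ℝ, F) ∞ p x) :
    ∃ s : C → L, s (p x) = x ∧ ContMDiffAt 𝓘(ℝ, F) 𝓘(ℝ, G) ∞ s (p x) ∧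
      ∀ᶠ c in 𝓝 (p x), p (s c) = c := by
  obtain ⟨Φ, ψ, hx, hpx, hmaps, -, hΦs, hψ, hp⟩ := exists_charts_of_isSubmersionAtOfComplement h
  have hψx : ψ (p x) = (Φ x).1 := hp x hx
  have hΦx : (ψ (p x), (Φ x).2) = Φ x := Prod.ext hψx rfl
  -- The section freezes the `K`-coordinate at its value at `x`.
  have hc : ContMDiffAt 𝓘(ℝ, F) 𝓘(ℝ, F × K) ∞ (fun c => (ψ c, (Φ x).2)) (p x) :=
    (hψ.contMDiffAt (ψ.open_source.mem_nhds hpx)).prodMk_space contMDiffAt_const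
  refine ⟨fun c => Φ.symm (ψ c, (Φ x).2), ?_, ?_, ?_⟩
  · simp only [hΦx, Φ.left_inv hx]
  · refine ContMDiffAt.comp (p x) (hΦs.contMDiffAt (Φ.open_target.mem_nhds ?_)) hc
    rw [hΦx]
    exact Φ.map_source hx
  · have hT : ∀ᶠ c in 𝓝 (p x), (ψ c, (Φ x).2) ∈ Φ.target :=
      hc.continuousAt.eventually
        (Φ.open_target.mem_nhds (by simpa only [hΦx] using Φ.map_source hx))
    filter_upwards [hT, ψ.open_source.mem_nhds hpx] with c hc₁ hc₂
    refine ψ.injOn (hmaps (Φ.map_target hc₁)) hc₂ ?_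
    rw [hp _ (Φ.map_target hc₁), Φ.right_inv hc₁]

/-- The fibre of a submersion through a point `x` is locally parametrized by the complement. -/
theorem exists_fibre_parametrization_of_isSubmersionAtOfComplement
    (h : IsSubmersionAtOfComplement K 𝓘(ℝ, G) 𝓘(ℝ, F) ∞ p x) :
    ∃ (k₀ : K) (r : ℝ) (σ : K → L), 0 < r ∧ σ k₀ = x ∧
      ContMDiffOn 𝓘(ℝ, K) 𝓘(ℝ, G) ∞ σ (Metric.ball k₀ r) ∧
      (∀ k ∈ Metric.ball k₀ r, p (σ k) = p x) ∧
      Function.Injective (mfderiv 𝓘(ℝ, K) 𝓘(ℝ, G) σ k₀) ∧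
      ∀ᶠ y in 𝓝 x, p y = p x → y ∈ σ '' Metric.ball k₀ r := by
  obtain ⟨Φ, ψ, hx, hpx, hmaps, hΦ, hΦs, -, hp⟩ := exists_charts_of_isSubmersionAtOfComplement h
  -- The fibre is the slice where the `F`-coordinate is frozen; `r` is chosen so that the ball in
  -- this slice stays in the chart.
  have hemb : ContDiff ℝ ∞ (fun k : K => ((Φ x).1, k)) := contDiff_const.prodMk contDiff_id
  obtain ⟨r, hr, hball⟩ := Metric.mem_nhds_iff.1 (hemb.continuous.continuousAt.preimage_mem_nhds
    (x := (Φ x).2) (Φ.open_target.mem_nhds (Φ.map_source hx)))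
  have hσ : ContMDiffOn 𝓘(ℝ, K) 𝓘(ℝ, G) ∞ (fun k => Φ.symm ((Φ x).1, k))
      (Metric.ball (Φ x).2 r) :=
    hΦs.comp hemb.contMDiff.contMDiffOn fun k hk => hball hk
  have hk₀ : (Φ x).2 ∈ Metric.ball (Φ x).2 r := Metric.mem_ball_self hr
  refine ⟨(Φ x).2, r, fun k => Φ.symm ((Φ x).1, k), hr, Φ.left_inv hx, hσ, ?_, ?_, ?_⟩
  · intro k hk
    refine ψ.injOn (hmaps (Φ.map_target (hball hk))) hpx ?_
    rw [hp _ (Φ.map_target (hball hk)), Φ.right_inv (hball hk), hp x hx]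
  · have h₁ : MDifferentiableAt 𝓘(ℝ, K) 𝓘(ℝ, G) (fun k => Φ.symm ((Φ x).1, k)) (Φ x).2 :=
      (hσ.contMDiffAt (Metric.isOpen_ball.mem_nhds hk₀)).mdifferentiableAt (by simp)
    have h₂ : MDifferentiableAt 𝓘(ℝ, G) 𝓘(ℝ, K) (Prod.snd ∘ Φ) (Φ.symm ((Φ x).1, (Φ x).2)) := by
      have hx' : Φ.symm ((Φ x).1, (Φ x).2) = x := Φ.left_inv hx
      rw [hx']
      exact (contDiff_snd.contMDiff.contMDiffAt.comp x
        (hΦ.contMDiffAt (Φ.open_source.mem_nhds hx))).mdifferentiableAt (n := ∞) (by simp)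
    have heq : (Prod.snd ∘ Φ) ∘ (fun k => Φ.symm ((Φ x).1, k)) =ᶠ[𝓝 (Φ x).2] id := by
      filter_upwards [Metric.isOpen_ball.mem_nhds hk₀] with k hk
      simp [Φ.right_inv (hball hk)]
    have hid : Function.Injective (mfderiv 𝓘(ℝ, K) 𝓘(ℝ, K) (id : K → K) (Φ x).2) := by
      rw [mfderiv_id]
      exact Function.injective_id
    rw [← heq.mfderiv_eq] at hid
    exact injective_mfderiv_of_comp h₂ h₁ hid
  · have hball' : ∀ᶠ y in 𝓝 x, (Φ y).2 ∈ Metric.ball (Φ x).2 r :=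
      (continuous_snd.continuousAt.comp (Φ.continuousAt hx)).eventually
        (Metric.isOpen_ball.mem_nhds hk₀)
    filter_upwards [hball', Φ.open_source.mem_nhds hx] with y hy₁ hy₂ hpy
    refine ⟨(Φ y).2, hy₁, ?_⟩
    have : ((Φ x).1, (Φ y).2) = Φ y := Prod.ext (by rw [← hp x hx, ← hp y hy₂, hpy]) rfl
    simp only [this, Φ.left_inv hy₂]

/-- A local section `s` through `x` gives `Tp ∘ Ts = id`. -/
theorem surjective_mfderiv_of_isSubmersion (hp : IsSubmersion 𝓘(ℝ, G) 𝓘(ℝ, F) ∞ p) (x : L) :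
    Function.Surjective (mfderiv 𝓘(ℝ, G) 𝓘(ℝ, F) p x) := by
  obtain ⟨s, hsx, hs, hps⟩ := exists_section_of_isSubmersionAtOfComplement
    (hp.isSubmersionOfComplement_complement x)
  have h₁ : MDifferentiableAt 𝓘(ℝ, G) 𝓘(ℝ, F) p (s (p x)) :=
    (hp.contMDiff _).mdifferentiableAt (by simp)
  have hid : Function.Surjective (mfderiv 𝓘(ℝ, F) 𝓘(ℝ, F) (id : C → C) (p x)) := by
    rw [mfderiv_id]
    exact Function.surjective_id
  have heq : p ∘ s =ᶠ[𝓝 (p x)] id := hps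
  rw [← heq.mfderiv_eq] at hid
  have := surjective_mfderiv_of_comp h₁ (hs.mdifferentiableAt (by simp)) hid
  rwa [hsx] at this

/-- A function whose differential vanishes on the vertical vectors of a submersion is locally
constant along the fibres. -/
theorem eventually_eq_of_mfderiv_vertical_eq_zero (hp : IsSubmersion 𝓘(ℝ, G) 𝓘(ℝ, F) ∞ p)
    {f : L → ℝ} (hf : MDifferentiable 𝓘(ℝ, G) 𝓘(ℝ, ℝ) f)
    (hvert : ∀ (y : L) (v : TangentSpace 𝓘(ℝ, G) y), mfderiv 𝓘(ℝ, G) 𝓘(ℝ, F) p y v = 0 →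
      mfderiv 𝓘(ℝ, G) 𝓘(ℝ, ℝ) f y v = 0) (x : L) :
    ∀ᶠ y in 𝓝 x, p y = p x → f y = f x := by
  obtain ⟨k₀, r, σ, hr, hσx, hσ, hpσ, -, hev⟩ :=
    exists_fibre_parametrization_of_isSubmersionAtOfComplement
      (hp.isSubmersionOfComplement_complement x)
  -- `p ∘ σ` is constant on the ball, so the image of `Tσ` is vertical.
  have hd : ∀ k ∈ Metric.ball k₀ r, HasFDerivAt (f ∘ σ) (0 : _ →L[ℝ] ℝ) k := by
    intro k hk
    have hσk : MDifferentiableAt _ 𝓘(ℝ, G) σ k :=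
      (hσ.contMDiffAt (Metric.isOpen_ball.mem_nhds hk)).mdifferentiableAt (by simp)
    have h₁ : HasMFDerivAt _ 𝓘(ℝ, ℝ) (f ∘ σ) k _ := (hf (σ k)).hasMFDerivAt.comp k hσk.hasMFDerivAt
    have h₂ : HasMFDerivAt _ 𝓘(ℝ, F) (p ∘ σ) k _ :=
      ((hp.contMDiff (σ k)).mdifferentiableAt (by simp)).hasMFDerivAt.comp k hσk.hasMFDerivAt
    have h₃ : p ∘ σ =ᶠ[𝓝 k] fun _ => p x := by
      filter_upwards [Metric.isOpen_ball.mem_nhds hk] with k' hk' using hpσ k' hk'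
    have h₄ := h₂.mfderiv.symm.trans (h₃.mfderiv_eq.trans mfderiv_const)
    rw [hasMFDerivAt_iff_hasFDerivAt] at h₁
    refine h₁.congr_fderiv (ContinuousLinearMap.ext fun v => hvert _ _ ?_)
    exact DFunLike.congr_fun h₄ v
  filter_upwards [hev] with y hy hpy
  obtain ⟨k, hk, rfl⟩ := hy hpy
  have := (convex_ball k₀ r).is_const_of_fderivWithin_eq_zero (𝕜 := ℝ) (f := f ∘ σ)
    (fun k hk => (hd k hk).differentiableAt.differentiableWithinAt)
    (fun k hk => ((hd k hk).hasFDerivWithinAt).fderivWithin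
      (Metric.isOpen_ball.uniqueDiffWithinAt hk)) hk (Metric.mem_ball_self hr)
  simpa [hσx] using this

/-- A smooth function whose differential vanishes on the vertical vectors of a surjective
submersion with connected fibres descends to a smooth function on the base. -/
theorem exists_contMDiff_descent (hp : IsSubmersion 𝓘(ℝ, G) 𝓘(ℝ, F) ∞ p)
    (hsurj : Function.Surjective p) (hconn : ∀ c : C, IsPreconnected (p ⁻¹' {c}))
    {f : L → ℝ} (hf : ContMDiff 𝓘(ℝ, G) 𝓘(ℝ, ℝ) ∞ f)
    (hvert : ∀ (y : L) (v : TangentSpace 𝓘(ℝ, G) y), mfderiv 𝓘(ℝ, G) 𝓘(ℝ, F) p y v = 0 →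
      mfderiv 𝓘(ℝ, G) 𝓘(ℝ, ℝ) f y v = 0) :
    ∃ g : C → ℝ, ContMDiff 𝓘(ℝ, F) 𝓘(ℝ, ℝ) ∞ g ∧ ∀ x, f x = g (p x) := by
  have hloc := eventually_eq_of_mfderiv_vertical_eq_zero hp (hf.mdifferentiable (by simp)) hvert
  have hconst : ∀ x y, p x = p y → f x = f y := by
    intro x y hxy
    have : PreconnectedSpace (p ⁻¹' {p y}) := isPreconnected_iff_preconnectedSpace.1 (hconn _)
    have hlc : IsLocallyConstant (fun z : p ⁻¹' {p y} => f z) := by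
      rw [IsLocallyConstant.iff_eventually_eq]
      intro z
      filter_upwards [continuous_subtype_val.continuousAt.eventually (hloc z)] with w hw
      exact hw (w.2.trans z.2.symm)
    exact hlc.apply_eq_of_preconnectedSpace ⟨x, hxy⟩ ⟨y, rfl⟩
  -- The chosen preimages need not vary continuously; by `hconst` the value agrees near `p x` with
  -- `f ∘ s` for a smooth local section `s`.
  refine ⟨fun c => f (Function.surjInv hsurj c), fun c => ?_,
    fun x => hconst _ _ (Function.surjInv_eq hsurj _).symm⟩
  obtain ⟨x, rfl⟩ := hsurj c
  obtain ⟨s, hsx, hs, hps⟩ := exists_section_of_isSubmersionAtOfComplement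
    (hp.isSubmersionOfComplement_complement x)
  refine ((hf (s (p x))).comp (p x) hs).congr_of_eventuallyEq ?_
  filter_upwards [hps] with c hc
  exact hconst _ _ ((Function.surjInv_eq hsurj c).trans hc.symm)

end Submersion

/-! ### Linear algebra and the inverse function theorem -/

/-- A map into an affine subspace of the same dimension with injective strict derivative is open
at the base point, as a map into that subspace. -/
theorem eventually_mem_image_of_injective_hasStrictFDerivAt
    {K V : Type*} [NormedAddCommGroup K] [NormedSpace ℝ K] [FiniteDimensional ℝ K]
    [NormedAddCommGroup V] [NormedSpace ℝ V] [FiniteDimensional ℝ V]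
    {φ : K → V} {D : K →L[ℝ] V} {k₀ : K} (hφ : HasStrictFDerivAt φ D k₀)
    (hD : Function.Injective D) (W : Submodule ℝ V) (hW : ∀ᶠ k in 𝓝 k₀, φ k - φ k₀ ∈ W)
    (hdim : Module.finrank ℝ W = Module.finrank ℝ K) {U : Set K} (hU : U ∈ 𝓝 k₀) :
    ∀ᶠ μ in 𝓝 (φ k₀), μ - φ k₀ ∈ W → μ ∈ φ '' U := by
  -- A linear projection onto `W` turns `φ - φ k₀` into a map `χ` with values in `W`; near `k₀`
  -- nothing is lost.
  obtain ⟨P₀, hP₀⟩ := W.subtype.exists_leftInverse_of_injective W.ker_subtype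
  let P : V →L[ℝ] W := P₀.toContinuousLinearMap
  have hP : ∀ w : W, P w = w := fun w => LinearMap.congr_fun hP₀ w
  let χ : K → W := fun k => P (φ k - φ k₀)
  have hχ : HasStrictFDerivAt χ (P.comp D) k₀ :=
    P.hasStrictFDerivAt.comp k₀ (hφ.sub_const (φ k₀))
  have hφχ : ∀ᶠ k in 𝓝 k₀, (χ k : V) = φ k - φ k₀ := by
    filter_upwards [hW] with k hk
    exact congrArg Subtype.val (hP ⟨_, hk⟩)
  -- `D` takes values in `W`, so `P ∘ D` inherits its injectivity and, the dimensions being equal,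
  -- is onto.
  have hDP : W.subtypeL.comp (P.comp D) = D := by
    have h₁ : HasFDerivAt (fun k => (χ k : V)) (W.subtypeL.comp (P.comp D)) k₀ :=
      W.subtypeL.hasFDerivAt.comp k₀ hχ.hasFDerivAt
    exact h₁.unique ((hφ.hasFDerivAt.sub_const (φ k₀)).congr_of_eventuallyEq hφχ)
  have hinj : Function.Injective (P.comp D) := by
    rw [← hDP] at hD
    exact Function.Injective.of_comp (f := W.subtypeL) hD
  have hsurj : (P.comp D).range = ⊤ := by
    rw [LinearMap.range_eq_top]
    exact (LinearMap.injective_iff_surjective_of_finrank_eq_finrank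
      (f := (P.comp D : K →ₗ[ℝ] W)) hdim.symm).1 hinj
  have hmap := hχ.map_nhds_eq_of_surj hsurj
  have himg : χ '' (U ∩ {k | (χ k : V) = φ k - φ k₀}) ∈ 𝓝 (χ k₀) := by
    rw [← hmap]
    exact image_mem_map (inter_mem hU hφχ)
  have hcont : ContinuousAt (fun μ => P (μ - φ k₀)) (φ k₀) := by fun_prop
  filter_upwards [hcont.eventually himg] with μ hμ hμW
  obtain ⟨k, ⟨hkU, hk⟩, hkμ⟩ := hμ
  refine ⟨k, hkU, ?_⟩
  have h₁ : (P (μ - φ k₀) : V) = μ - φ k₀ := congrArg Subtype.val (hP ⟨_, hμW⟩)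
  have h₂ : φ k - φ k₀ = μ - φ k₀ := by
    rw [← h₁, ← hkμ]
    exact hk.symm
  exact sub_left_injective h₂

theorem finrank_continuousDual (V : Type*) [NormedAddCommGroup V] [NormedSpace ℝ V]
    [FiniteDimensional ℝ V] : Module.finrank ℝ (V →L[ℝ] ℝ) = Module.finrank ℝ V :=
  (LinearMap.toContinuousLinearMap (𝕜 := ℝ) (E := V) (F' := ℝ)).finrank_eq.symm.trans
    Subspace.dual_finrank_eq

/-- The covectors vanishing on the image of an injective linear map form a subspace of
complementary dimension. -/
theorem finrank_ker_precomp {F V : Type*} [NormedAddCommGroup F] [NormedSpace ℝ F]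
    [FiniteDimensional ℝ F] [NormedAddCommGroup V] [NormedSpace ℝ V] [FiniteDimensional ℝ V]
    (T : F →L[ℝ] V) (hT : Function.Injective T) :
    Module.finrank ℝ F + Module.finrank ℝ ((ContinuousLinearMap.compL ℝ F V ℝ).flip T).ker
      = Module.finrank ℝ V := by
  -- Composing with a left inverse of `T` extends covectors from `F` to `V`, so restriction along
  -- `T` is onto and rank-nullity applies.
  obtain ⟨P, hP⟩ := (T : F →ₗ[ℝ] V).exists_leftInverse_of_injective (LinearMap.ker_eq_bot.2 hT)
  have hsurj : ((ContinuousLinearMap.compL ℝ F V ℝ).flip T).range = ⊤ := by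
    rw [LinearMap.range_eq_top]
    intro ν
    refine ⟨ν.comp P.toContinuousLinearMap, ContinuousLinearMap.ext fun v => ?_⟩
    exact congrArg ν (LinearMap.congr_fun hP v)
  have := LinearMap.finrank_range_add_finrank_ker
    ((ContinuousLinearMap.compL ℝ F V ℝ).flip T : (V →L[ℝ] ℝ) →ₗ[ℝ] (F →L[ℝ] ℝ))
  rw [hsurj, finrank_top, finrank_continuousDual, finrank_continuousDual] at this
  exact this

/-! ### Generating functions and openness in the fibres -/

section GeneratingFunction

variable {E : Type*} [NormedAddCommGroup E] [NormedSpace ℝ E] {H : Type*} [TopologicalSpace H]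
  {I : ModelWithCorners ℝ E H} {Q : Type*} [TopologicalSpace Q] [ChartedSpace H Q]
  [IsManifold I ∞ Q]
  {G : Type*} [NormedAddCommGroup G] [NormedSpace ℝ G]
  {N : Type*} [TopologicalSpace N] [ChartedSpace G N]
  {F : Type*} [NormedAddCommGroup F] [NormedSpace ℝ F]
  {C : Type*} [TopologicalSpace C] [ChartedSpace F C]
  {i : N → CotangentBundle I Q} {S : N → ℝ} {j : C → Q} {p : N → C}

theorem CotangentBundle.exists_eq_mk {γ : CotangentBundle I Q} {q : Q} (h : γ.proj = q) :
    ∃ μ : TangentSpace I q →L[ℝ] ℝ, γ = ⟨q, μ⟩ := by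
  subst h
  exact ⟨γ.2, rfl⟩

/-- `γ.2` and `μ` live in different fibre types; evaluating both on the common model space `E`
avoids a cast. -/
theorem CotangentBundle.snd_apply_of_eq_mk {γ : CotangentBundle I Q} {q : Q}
    {μ : TangentSpace I q →L[ℝ] ℝ} (h : γ = ⟨q, μ⟩) (v : E) :
    (γ.2 : E → ℝ) v = (μ : E → ℝ) v := by
  subst h
  rfl

/-- If the projection of `i` to the base factors as `j ∘ p`, then the differential of a generating
function is the pairing of `i x` with `Tj (Tp v)`. -/
theorem IsGeneratingFunction.apply_mfderiv_mfderiv (hS : IsGeneratingFunction I G i S)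
    (hi : MDifferentiable 𝓘(ℝ, G) (cotangentModel I) i) (hj : MDifferentiable 𝓘(ℝ, F) I j)
    (hpd : MDifferentiable 𝓘(ℝ, G) 𝓘(ℝ, F) p) (hp : ∀ x, j (p x) = (i x).proj) {x : N}
    {μ : TangentSpace I (j (p x)) →L[ℝ] ℝ} (hμ : i x = ⟨j (p x), μ⟩)
    (v : TangentSpace 𝓘(ℝ, G) x) :
    μ (mfderiv 𝓘(ℝ, F) I j (p x) (mfderiv 𝓘(ℝ, G) 𝓘(ℝ, F) p x v)) =
      mfderiv 𝓘(ℝ, G) 𝓘(ℝ, ℝ) S x v := by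
  rw [← hS.2 x v]
  have hproj : MDifferentiableAt (cotangentModel I) I
      (TotalSpace.proj : CotangentBundle I Q → Q) (i x) :=
    (contMDiff_proj (n := 1) _ _).mdifferentiableAt (by simp)
  have h₁ := (hproj.hasMFDerivAt.comp x (hi x).hasMFDerivAt).mfderiv
  have h₂ := ((hj (p x)).hasMFDerivAt.comp x (hpd x).hasMFDerivAt).mfderiv
  have h₃ : (TotalSpace.proj : CotangentBundle I Q → Q) ∘ i = j ∘ p := funext fun y => (hp y).symm
  rw [h₃] at h₁
  have h₄ := DFunLike.congr_fun (h₂.symm.trans h₁) v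
  refine (CotangentBundle.snd_apply_of_eq_mk hμ _).symm.trans ?_
  exact congrArg (i x).2 h₄

/-- Under a submersion onto the base submanifold, a fibre of an immersed submanifold of `T^*Q` of
half dimension is open in the affine space of covectors extending `df`. -/
theorem eventually_exists_eq_mk [FiniteDimensional ℝ E] [FiniteDimensional ℝ G]
    [FiniteDimensional ℝ F]
    (hi : ContMDiff 𝓘(ℝ, G) (cotangentModel I) ∞ i)
    (hi_inj : ∀ x, Function.Injective (mfderiv 𝓘(ℝ, G) (cotangentModel I) i x))
    (hp_subm : IsSubmersion 𝓘(ℝ, G) 𝓘(ℝ, F) ∞ p) (hp : ∀ x, j (p x) = (i x).proj)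
    (hdim : Module.finrank ℝ G = Module.finrank ℝ E) (f : C → ℝ)
    (hf : ∀ (x : N) (μ : TangentSpace I (j (p x)) →L[ℝ] ℝ), i x = ⟨j (p x), μ⟩ →
      ∀ v : TangentSpace 𝓘(ℝ, F) (p x),
        μ (mfderiv 𝓘(ℝ, F) I j (p x) v) = mfderiv 𝓘(ℝ, F) 𝓘(ℝ, ℝ) f (p x) v)
    (x : N) (hj_inj : Function.Injective (mfderiv 𝓘(ℝ, F) I j (p x)))
    (μ₀ : E →L[ℝ] ℝ) (hμ₀ : i x = ⟨j (p x), μ₀⟩) :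
    ∀ᶠ μ : E →L[ℝ] ℝ in 𝓝 μ₀, (∀ v : F,
      μ (mfderiv 𝓘(ℝ, F) I j (p x) v) = mfderiv 𝓘(ℝ, F) 𝓘(ℝ, ℝ) f (p x) v) →
      ∃ y, i y = ⟨j (p x), μ⟩ := by
  have hsub := hp_subm.isSubmersionOfComplement_complement x
  obtain ⟨k₀, r, σ, hr, hσx, hσ, hpσ, hσ_inj, -⟩ :=
    exists_fibre_parametrization_of_isSubmersionAtOfComplement hsub
  have hball : Metric.ball k₀ r ∈ 𝓝 k₀ := Metric.ball_mem_nhds k₀ hr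
  have hiσ : ContMDiffAt 𝓘(ℝ, hp_subm.complement) (cotangentModel I) ∞ (i ∘ σ) k₀ :=
    (hi (σ k₀)).comp k₀ (hσ.contMDiffAt hball)
  -- The covector `i (σ k)` read in the trivialization at `j (p x)`. Along the fibre the base point
  -- stays there, where this trivialization is the identity, so `φ k` is the covector itself.
  let φ : hp_subm.complement → E →L[ℝ] ℝ := fun k =>
    (trivializationAt (E →L[ℝ] ℝ) (fun q : Q => TangentSpace I q →L[ℝ] ℝ) (j (p x)) (i (σ k))).2
  have hφ : ContDiffAt ℝ ∞ φ k₀ := by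
    have h := (contMDiffAt_totalSpace.1 hiσ).2
    have hq : ((i ∘ σ) k₀).proj = j (p x) := by rw [hp, Function.comp_apply, hσx]
    rw [hq] at h
    exact h.contDiffAt
  have hφi : ∀ k ∈ Metric.ball k₀ r, i (σ k) = ⟨j (p x), φ k⟩ := by
    intro k hk
    obtain ⟨μ, hμ⟩ := CotangentBundle.exists_eq_mk (γ := i (σ k)) (q := j (p x))
      (by rw [← hp, hpσ k hk])
    have : φ k = μ := by
      simp only [φ, hμ]
      exact trivializationAt_cotangentBundle_snd_self _ _
    rw [this, hμ]
  have hφ₀ : φ k₀ = μ₀ := by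
    simp only [φ, hσx, hμ₀]
    exact trivializationAt_cotangentBundle_snd_self _ _
  have hφA : ∀ k ∈ Metric.ball k₀ r, ∀ v : F,
      φ k (mfderiv 𝓘(ℝ, F) I j (p x) v) = mfderiv 𝓘(ℝ, F) 𝓘(ℝ, ℝ) f (p x) v := by
    intro k hk
    have h := hf (σ k)
    rw [hpσ k hk] at h
    exact h (φ k) (hφi k hk)
  -- Near `k₀`, following `φ` by the inclusion of the cotangent fibre gives `i ∘ σ`, a composition
  -- of maps with injective derivatives.
  have hD : Function.Injective (fderiv ℝ φ k₀) := by
    rw [← mfderiv_eq_fderiv]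
    refine injective_mfderiv_of_comp (I₃ := cotangentModel I)
      (g := fun μ : E →L[ℝ] ℝ => (⟨j (p x), μ⟩ : CotangentBundle I Q))
      ((contMDiff_cotangentBundle_mk _).mdifferentiableAt (by simp))
      (hφ.differentiableAt (by simp)).mdifferentiableAt ?_
    have heq : (fun μ : E →L[ℝ] ℝ => (⟨j (p x), μ⟩ : CotangentBundle I Q)) ∘ φ =ᶠ[𝓝 k₀] i ∘ σ := by
      filter_upwards [hball] with k hk using (hφi k hk).symm
    rw [heq.mfderiv_eq, mfderiv_comp k₀ ((hi _).mdifferentiableAt (by simp))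
      ((hσ.contMDiffAt hball).mdifferentiableAt (by simp))]
    exact (hi_inj (σ k₀)).comp hσ_inj
  let T : F →L[ℝ] E := mfderiv 𝓘(ℝ, F) I j (p x)
  let W := ((ContinuousLinearMap.compL ℝ F E ℝ).flip T).ker
  have hmemW : ∀ ν : E →L[ℝ] ℝ, (∀ v, ν (T v) = 0) → ν ∈ W := fun ν hν =>
    LinearMap.mem_ker.2 (ContinuousLinearMap.ext hν)
  have hK : FiniteDimensional ℝ hp_subm.complement :=
    Module.Finite.of_surjective ((LinearMap.snd ℝ F hp_subm.complement).comp
      (hsub.equiv : G →ₗ[ℝ] F × hp_subm.complement))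
      (Prod.snd_surjective.comp hsub.equiv.surjective)
  -- Here `dim F + dim W = dim E = dim G = dim F + dim K`, with `K` the complement of the
  -- submersion.
  have hdimW : Module.finrank ℝ W = Module.finrank ℝ hp_subm.complement := by
    have h₁ := finrank_ker_precomp T hj_inj
    have h₂ := hsub.equiv.toLinearEquiv.finrank_eq
    rw [Module.finrank_prod] at h₂
    change Module.finrank ℝ F + Module.finrank ℝ W = _ at h₁
    omega
  have key := eventually_mem_image_of_injective_hasStrictFDerivAt
    (hφ.hasStrictFDerivAt (by simp)) hD W ?_ hdimW hball
  · rw [hφ₀] at key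
    filter_upwards [key] with μ hμ hμA
    obtain ⟨k, hk, rfl⟩ := hμ (hmemW _ fun v => by
      rw [← hφ₀]
      exact sub_eq_zero.2 ((hμA v).trans (hφA k₀ (Metric.mem_ball_self hr) v).symm))
    exact ⟨σ k, hφi k hk⟩
  · filter_upwards [hball] with k hk
    exact hmemW _ fun v => sub_eq_zero.2
      ((hφA k hk v).trans (hφA k₀ (Metric.mem_ball_self hr) v).symm)

end GeneratingFunction

/-! ### Connectedness argument and the main theorem -/

/-- A nonempty closed subset of a convex set which is relatively open in it is the whole set. -/
theorem Convex.subset_of_isClosed_of_eventually {V : Type*} [NormedAddCommGroup V]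
    [NormedSpace ℝ V] {A B : Set V} (hA : Convex ℝ A) (hB : IsClosed B) (hne : (A ∩ B).Nonempty)
    (hev : ∀ μ ∈ A ∩ B, ∀ᶠ ν in 𝓝 μ, ν ∈ A → ν ∈ B) : A ⊆ B := by
  have : PreconnectedSpace A := isPreconnected_iff_preconnectedSpace.1 hA.isPreconnected
  have hclopen : IsClopen ((↑) ⁻¹' B : Set A) := by
    refine ⟨hB.preimage continuous_subtype_val, isOpen_iff_mem_nhds.2 fun μ hμ => ?_⟩
    filter_upwards [continuous_subtype_val.continuousAt.eventually (hev μ ⟨μ.2, hμ⟩)] with ν hν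
    exact hν ν.2
  obtain ⟨μ, hμA, hμB⟩ := hne
  have huniv := hclopen.eq_univ ⟨⟨μ, hμA⟩, hμB⟩
  intro ν hν
  have : (⟨ν, hν⟩ : A) ∈ ((↑) ⁻¹' B : Set A) := huniv ▸ mem_univ _
  exact this

end DiscreteMechanics

open DiscreteMechanics in
theorem theorem5p1
    {E : Type*} [NormedAddCommGroup E] [NormedSpace ℝ E] [FiniteDimensional ℝ E]
    {M : Type*} [TopologicalSpace M] [ChartedSpace E M] [IsManifold 𝓘(ℝ, E) ∞ M]
    -- the Lagrangian submanifold `Λ = range ι` of `(T^*M × T^*M, Ω)`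
    {G : Type*} [NormedAddCommGroup G] [NormedSpace ℝ G] [FiniteDimensional ℝ G]
    {L : Type*} [TopologicalSpace L] [ChartedSpace G L] [IsManifold 𝓘(ℝ, G) ∞ L]
    (ι : L → CotangentBundle 𝓘(ℝ, E) M × CotangentBundle 𝓘(ℝ, E) M)
    (hι : IsLagrangianSubmanifold
      ((cotangentModel 𝓘(ℝ, E)).prod (cotangentModel 𝓘(ℝ, E))) (productForm 𝓘(ℝ, E)) G ι)
    -- the generating function of `Υ⁻¹(Λ)`, whose inclusion is `Υ⁻¹ ∘ ι`
    (S : L → ℝ)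
    (hS : IsGeneratingFunction (𝓘(ℝ, E).prod 𝓘(ℝ, E)) G ((upsilon 𝓘(ℝ, E) M).symm ∘ ι) S)
    -- the submanifold `C_d` of `M × M`, with inclusion `j`
    {F : Type*} [NormedAddCommGroup F] [NormedSpace ℝ F] [FiniteDimensional ℝ F]
    {C : Type*} [TopologicalSpace C] [ChartedSpace F C] [IsManifold 𝓘(ℝ, F) ∞ C]
    (j : C → M × M) (hj : IsSmoothEmbedding 𝓘(ℝ, F) (𝓘(ℝ, E).prod 𝓘(ℝ, E)) ∞ j)
    -- the restriction `p` of `π_{M × M}` to `Υ⁻¹(Λ)`: a submersion onto `C_d`, connected fibres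
    (p : L → C) (hp : ∀ x, j (p x) = ((upsilon 𝓘(ℝ, E) M).symm (ι x)).proj)
    (hp_subm : IsSubmersion 𝓘(ℝ, G) 𝓘(ℝ, F) ∞ p)
    (hp_surj : Function.Surjective p)
    (hp_conn : ∀ c : C, IsConnected (p ⁻¹' {c})) :
    ∃ Ld : C → ℝ, ContMDiff 𝓘(ℝ, F) 𝓘(ℝ, ℝ) ∞ Ld ∧ (∀ x, S x = Ld (p x)) ∧
      upsilon 𝓘(ℝ, E) M ⁻¹' range ι ⊆ sigma (𝓘(ℝ, E).prod 𝓘(ℝ, E)) F j Ld ∧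
      ((∀ q : M × M, IsClosed {μ : TangentSpace (𝓘(ℝ, E).prod 𝓘(ℝ, E)) q →L[ℝ] ℝ |
          (⟨q, μ⟩ : CotangentBundle (𝓘(ℝ, E).prod 𝓘(ℝ, E)) (M × M)) ∈
            upsilon 𝓘(ℝ, E) M ⁻¹' range ι}) →
        upsilon 𝓘(ℝ, E) M ⁻¹' range ι = sigma (𝓘(ℝ, E).prod 𝓘(ℝ, E)) F j Ld ∧
        range ι = discreteDynamics 𝓘(ℝ, E) F j Ld) := by
  set Υ := upsilon 𝓘(ℝ, E) M
  have hi : ContMDiff 𝓘(ℝ, G) (cotangentModel (𝓘(ℝ, E).prod 𝓘(ℝ, E))) ∞ (Υ.symm ∘ ι) :=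
    contMDiff_upsilon_symm.comp hι.isSmoothEmbedding.contMDiff
  have hi_inj : ∀ x, Function.Injective
      (mfderiv 𝓘(ℝ, G) (cotangentModel (𝓘(ℝ, E).prod 𝓘(ℝ, E))) (Υ.symm ∘ ι) x) := by
    intro x
    refine injective_mfderiv_of_comp (g := Υ)
      (I₃ := (cotangentModel 𝓘(ℝ, E)).prod (cotangentModel 𝓘(ℝ, E)))
      (contMDiff_upsilon.mdifferentiableAt (by simp)) (hi.mdifferentiableAt (by simp)) ?_
    have : Υ ∘ Υ.symm ∘ ι = ι := by
      rw [← Function.comp_assoc, Equiv.self_comp_symm, Function.id_comp]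
    rw [this]
    exact injective_mfderiv_of_isImmersion hι.isSmoothEmbedding.isImmersion x
  have hmem : ∀ γ, γ ∈ Υ ⁻¹' range ι ↔ ∃ x, (Υ.symm ∘ ι) x = γ := fun γ =>
    exists_congr fun x => (Equiv.symm_apply_eq Υ).symm
  -- The basic identity `dS_x(v) = ⟨i x, Tj (Tp v)⟩`.
  have hpair : ∀ (x : L) (μ : TangentSpace (𝓘(ℝ, E).prod 𝓘(ℝ, E)) (j (p x)) →L[ℝ] ℝ),
      (Υ.symm ∘ ι) x = ⟨j (p x), μ⟩ → ∀ v : TangentSpace 𝓘(ℝ, G) x,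
      μ (mfderiv 𝓘(ℝ, F) (𝓘(ℝ, E).prod 𝓘(ℝ, E)) j (p x) (mfderiv 𝓘(ℝ, G) 𝓘(ℝ, F) p x v)) =
        mfderiv 𝓘(ℝ, G) 𝓘(ℝ, ℝ) S x v := fun x μ hμ v =>
    hS.apply_mfderiv_mfderiv (hi.mdifferentiable (by simp)) (hj.contMDiff.mdifferentiable (by simp))
      (hp_subm.contMDiff.mdifferentiable (by simp)) hp hμ v
  obtain ⟨Ld, hLd, hSLd⟩ := exists_contMDiff_descent hp_subm hp_surj
    (fun c => (hp_conn c).isPreconnected) hS.1 (fun x v hv => by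
      obtain ⟨μ, hμ⟩ := CotangentBundle.exists_eq_mk (hp x).symm
      rw [← hpair x μ hμ v, hv, map_zero, map_zero]
      rfl)
  have hSigma : ∀ (x : L) (μ : TangentSpace (𝓘(ℝ, E).prod 𝓘(ℝ, E)) (j (p x)) →L[ℝ] ℝ),
      (Υ.symm ∘ ι) x = ⟨j (p x), μ⟩ → ∀ v : TangentSpace 𝓘(ℝ, F) (p x),
      μ (mfderiv 𝓘(ℝ, F) (𝓘(ℝ, E).prod 𝓘(ℝ, E)) j (p x) v) =
        mfderiv 𝓘(ℝ, F) 𝓘(ℝ, ℝ) Ld (p x) v := by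
    intro x μ hμ v
    -- Lifting `v` to `w` reduces the claim to `hpair` and the chain rule for `S = Ld ∘ p`.
    obtain ⟨w, rfl⟩ := surjective_mfderiv_of_isSubmersion hp_subm x v
    rw [hpair x μ hμ w, show S = Ld ∘ p from funext hSLd,
      mfderiv_comp x (hLd.mdifferentiableAt (by simp))
        (hp_subm.contMDiff.mdifferentiableAt (by simp))]
    rfl
  have hsub : Υ ⁻¹' range ι ⊆ sigma (𝓘(ℝ, E).prod 𝓘(ℝ, E)) F j Ld := by
    intro γ hγ
    obtain ⟨x, rfl⟩ := (hmem γ).1 hγ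
    obtain ⟨μ, hμ⟩ := CotangentBundle.exists_eq_mk (hp x).symm
    exact ⟨p x, μ, hμ, hSigma x μ hμ⟩
  refine ⟨Ld, hLd, hSLd, hsub, fun hclosed => ?_⟩
  have heq : Υ ⁻¹' range ι = sigma (𝓘(ℝ, E).prod 𝓘(ℝ, E)) F j Ld := by
    refine hsub.antisymm ?_
    rintro _ ⟨c, μ, rfl, hμ⟩
    -- Half of `dim (T^*M × T^*M) = 4 dim M` is `dim (M × M)`.
    have hdim : Module.finrank ℝ G = Module.finrank ℝ (E × E) := by
      have h := hι.two_mul_dim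
      simp only [Module.finrank_prod, finrank_continuousDual] at h ⊢
      omega
    have hbase : ∀ (x : L) (ν : E × E →L[ℝ] ℝ), (Υ.symm ∘ ι) x = ⟨j c, ν⟩ → p x = c := by
      intro x ν hx
      exact hj.isEmbedding.injective ((hp x).trans (congrArg TotalSpace.proj hx))
    -- The affine fibre of `Σ_{L_d}` over `c`, in which the fibre of `N` is shown to be nonempty,
    -- closed and open.
    let A : Set (E × E →L[ℝ] ℝ) := {ν | ∀ v : F,
      ν (mfderiv 𝓘(ℝ, F) (𝓘(ℝ, E).prod 𝓘(ℝ, E)) j c v) = mfderiv 𝓘(ℝ, F) 𝓘(ℝ, ℝ) Ld c v}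
    have hA : Convex ℝ A := by
      intro ν₁ h₁ ν₂ h₂ a b _ _ hab v
      change a * ν₁ _ + b * ν₂ _ = _
      rw [h₁ v, h₂ v]
      exact Convex.combo_self hab (M := ℝ) _
    refine Convex.subset_of_isClosed_of_eventually hA (hclosed (j c)) ?_ ?_ hμ
    · obtain ⟨x, rfl⟩ := hp_surj c
      obtain ⟨ν, hν⟩ := CotangentBundle.exists_eq_mk (hp x).symm
      exact ⟨ν, hSigma x ν hν, (hmem _).2 ⟨x, hν⟩⟩
    · rintro ν ⟨-, hν⟩
      obtain ⟨x, hx⟩ := (hmem _).1 hν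
      obtain rfl := hbase x ν hx
      filter_upwards [eventually_exists_eq_mk hi hi_inj hp_subm hp hdim Ld hSigma x
        (injective_mfderiv_of_isImmersion hj.isImmersion (p x)) ν hx] with ν' hν' hA'
      exact (hmem _).2 (hν' hA')
  refine ⟨heq, ?_⟩
  rw [discreteDynamics, ← heq, image_preimage_eq _ Υ.surjective]
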